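/- Let $\{x_i\}_{i\in\mathcal I}$ and $\{x_j\}_{j\in\mathcal J}$ be finite families of points in $\mathbb R^n$, and let $(w,V,b):[0,\infty)\to\mathbb R^r\times\mathbb R^{r\times n}\times\mathbb R^r$ be the trajectory of continuous-time gradient descent (gradient flow, from an arbitrary initialization) on the cross-entropy loss \[ \sum_{i\in\mathcal I}\log\left(1+e^{-w^\top(Vx_i+b)_+}\right)+\sum_{j\in\mathcal J}\log\left(1+e^{w^\top(Vx_j+b)_+}\right), \] where $(\cdot)_+=\max(\cdot,0)$ entrywise, the derivative of the ReLU at a pre-activation $u$ is taken to be $\mathbf 1_{\{u>0\}}$, and the gradient-flow equation is understood in integrated form. Assume that - all training points are correctly classified, i.e. for all large $t$, $w^\top(Vx_i+b)_+>0$ for all $i\in\mathcal I$ and $w^\top(Vx_j+b)_+<0$ for all $j\in\mathcal J$; - $(w,V,b)$ converges in direction to $(\overline w,\overline V,\overline b)$: at least one of $\|w(t)\|_2,\|V(t)\|_F,\|b(t)\|_2$ tends to $\infty$, the triple $(\overline w,\overline V,\overline b)$ is not zero, and for some $h:[0,\infty)\to(0,\infty)$ diverging to $+\infty$ each of $\|w(t)-h(t)\overline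 w\|_2/h(t)$, $\|V(t)-h(t)\overline V\|_F/h(t)$, $\|b(t)-h(t)\overline b\|_2/h(t)$ tends to $0$ as $t\to\infty$; - $(\overline w,\overline V,\overline b)$ is scaled such that $\overline w^\top(\overline Vx_i+\overline b)_+\ge 1$ for all $i\in\mathcal I$ and $\overline w^\top(\overline Vx_j+\overline b)_+\le -1$ for all $j\in\mathcal J$, with equality for at least one point. The points $s$ that achieve equality are called the support vectors, and $\mathcal I_{\rm sup}\cup\mathcal J_{\rm sup}$ denotes the set of their indices. A point $x$ activates node $k\in[r]$ of the limit network if $\overline V_kx+\overline b_k>0$, where $\overline V_k,\overline b_k$ are the $k$-th rows of $\overline V,\overline b$; - switching of the activations ends: if a support vector $x_s$ and a node $k$ with $\overline w_k\ne0$ satisfy $\overline V_kx_s+\overline b_k=0$ exactly, then $V_k(t)x_s+b_k(t)\le0$ for all sufficiently large $t$. For each $k$ let $X_k$ be the matrix whose columns are the support vectors that activate node $k$, and let $\underline\lambda>0$ be a lower bound for the minimum eigenvalue of $X_k^\top X_k$ for every $k\in[r]$ for which $X_k$ has at least one column (so these support vectors are linearly independent, for each node). Then the mapping $x\mapsto\overline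 w^\top(\overline Vx+\overline b)_+$ is Lipschitz (in the Euclidean norm) with constant at most \[ \frac{n_{\rm node}^{\min}\sqrt{n_{\rm sup}^{\max}}}{\sqrt{\underline\lambda}}, \] where \[ n_{\rm sup}^{\max}=\max_{k\in[r]}\ \max_{S\subseteq\mathcal I_{\rm sup}\cup\mathcal J_{\rm sup}}\left\{|S|:\overline V_kx_s+\overline b_k>0\ \ \forall s\in S\right\} \] is the maximum number of support vectors that activate the same node, and \[ n_{\rm node}^{\min}=\min_{K\subseteq[r]}\left\{|K|:\max_{k\in K}\left(\overline V_kx_s+\overline b_k\right)>0\ \ \forall s\in\mathcal I_{\rm sup}\cup\mathcal J_{\rm sup}\right\} \] is the minimum size of a set of nodes such that every support vector activates at least one of them. -/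

import Mathlib

open MeasureTheory Filter Topology

noncomputable section

namespace TwoLayerReLU

/-- The parameters `(w, V, b)` of the network `x ↦ wᵀ (V x + b)₊` with `r` hidden nodes on `ℝⁿ`. -/
structure Params (r n : ℕ) where
  w : EuclideanSpace ℝ (Fin r)
  V : Matrix (Fin r) (Fin n) ℝ
  b : EuclideanSpace ℝ (Fin r)

/-- The pre-activation `V_k x + b_k` of hidden node `k` at the input `x`. -/
def preact {r n : ℕ} (θ : Params r n) (x : EuclideanSpace ℝ (Fin n)) (k : Fin r) : ℝ :=
  (∑ l, θ.V k l * x l) + θ.b k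

/-- The network `wᵀ (V x + b)₊`. -/
def network {r n : ℕ} (θ : Params r n) (x : EuclideanSpace ℝ (Fin n)) : ℝ :=
  ∑ k, θ.w k * max (preact θ x k) 0

/-- The cross-entropy loss of the two classes `{xI i}` (positive) and `{xJ j}` (negative). -/
def loss {r n : ℕ} {I J : Type*} [Fintype I] [Fintype J]
    (xI : I → EuclideanSpace ℝ (Fin n)) (xJ : J → EuclideanSpace ℝ (Fin n))
    (θ : Params r n) : ℝ :=
  (∑ i, Real.log (1 + Real.exp (-network θ (xI i)))) +
    ∑ j, Real.log (1 + Real.exp (network θ (xJ j)))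

/-- The diagonal entry `(G_x)_{kk} = 1_{V_k x + b_k > 0}`, i.e. the derivative of the ReLU at the
pre-activation of node `k`, with the convention that this derivative is `0` at `0`. -/
def gate {r n : ℕ} (θ : Params r n) (x : EuclideanSpace ℝ (Fin n)) (k : Fin r) : ℝ :=
  if 0 < preact θ x k then 1 else 0

/-- `e^{-z} / (1 + e^{-z})`, minus the derivative of `z ↦ log (1 + e^{-z})`. -/
def lossWeight (z : ℝ) : ℝ := Real.exp (-z) / (1 + Real.exp (-z))

section Gradient

variable {r n : ℕ} {I J : Type*} [Fintype I] [Fintype J]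
  (xI : I → EuclideanSpace ℝ (Fin n)) (xJ : J → EuclideanSpace ℝ (Fin n))

/-- Minus the partial derivative of the loss with respect to `w_k`. -/
def negGradW (θ : Params r n) (k : Fin r) : ℝ :=
  (∑ i, gate θ (xI i) k * preact θ (xI i) k * lossWeight (network θ (xI i))) -
    ∑ j, gate θ (xJ j) k * preact θ (xJ j) k * lossWeight (-network θ (xJ j))

/-- Minus the partial derivative of the loss with respect to `V_{kl}`. -/
def negGradV (θ : Params r n) (k : Fin r) (l : Fin n) : ℝ :=
  (∑ i, gate θ (xI i) k * θ.w k * xI i l * lossWeight (network θ (xI i))) -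
    ∑ j, gate θ (xJ j) k * θ.w k * xJ j l * lossWeight (-network θ (xJ j))

/-- Minus the partial derivative of the loss with respect to `b_k`. -/
def negGradB (θ : Params r n) (k : Fin r) : ℝ :=
  (∑ i, gate θ (xI i) k * θ.w k * lossWeight (network θ (xI i))) -
    ∑ j, gate θ (xJ j) k * θ.w k * lossWeight (-network θ (xJ j))

end Gradient

/-- The parameters `θ + ε δ`. -/
def Params.line {r n : ℕ} (θ δ : Params r n) (ε : ℝ) : Params r n :=
  ⟨θ.w + ε • δ.w, θ.V + ε • δ.V, θ.b + ε • δ.b⟩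

theorem hasDerivAt_network_line {r n : ℕ} (θ δ : Params r n) (x : EuclideanSpace ℝ (Fin n))
    (hx : ∀ k, preact θ x k ≠ 0) :
    HasDerivAt (fun ε => network (θ.line δ ε) x)
      (∑ k, (gate θ x k * preact θ x k * δ.w k +
        gate θ x k * θ.w k * ((∑ l, x l * δ.V k l) + δ.b k))) 0 := by
  have hpre : ∀ k, HasDerivAt (fun ε => preact (θ.line δ ε) x k)
      ((∑ l, x l * δ.V k l) + δ.b k) 0 := by
    intro k
    have h : (fun ε => preact (θ.line δ ε) x k) =
        fun ε => preact θ x k + ε * ((∑ l, x l * δ.V k l) + δ.b k) := by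
      funext ε
      simp only [preact, Params.line, Matrix.add_apply, Matrix.smul_apply, PiLp.add_apply,
        PiLp.smul_apply, smul_eq_mul, mul_add, Finset.mul_sum, add_mul, Finset.sum_add_distrib]
      rw [Finset.sum_congr rfl (fun l _ => show ε * δ.V k l * x l = ε * (x l * δ.V k l) by ring)]
      ring
    rw [h]
    simpa using ((hasDerivAt_id (0 : ℝ)).mul_const ((∑ l, x l * δ.V k l) + δ.b k)).const_add
      (preact θ x k)
  have h0 : θ.line δ 0 = θ := by simp [Params.line]
  have hrelu : ∀ k, HasDerivAt (fun ε => max (preact (θ.line δ ε) x k) 0)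
      (gate θ x k * ((∑ l, x l * δ.V k l) + δ.b k)) 0 := by
    intro k
    have hc := (hpre k).continuousAt
    rcases lt_or_gt_of_ne (hx k) with hk | hk
    · have he : ∀ᶠ ε in 𝓝 (0 : ℝ), preact (θ.line δ ε) x k < 0 :=
        hc.eventually_lt continuousAt_const (by simpa [h0] using hk)
      have : gate θ x k = 0 := by simp [gate, hk.le]
      rw [this, zero_mul]
      exact (hasDerivAt_const (0 : ℝ) (0 : ℝ)).congr_of_eventuallyEq
        (he.mono fun ε h => max_eq_right h.le)
    · have he : ∀ᶠ ε in 𝓝 (0 : ℝ), 0 < preact (θ.line δ ε) x k :=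
        continuousAt_const.eventually_lt hc (by simpa [h0] using hk)
      have : gate θ x k = 1 := by simp [gate, hk]
      rw [this, one_mul]
      exact (hpre k).congr_of_eventuallyEq (he.mono fun ε h => max_eq_left h.le)
  unfold network
  refine HasDerivAt.fun_sum fun k _ => ?_
  have hw : HasDerivAt (fun ε => (θ.line δ ε).w k) (δ.w k) 0 := by
    simpa [Params.line] using ((hasDerivAt_id (0 : ℝ)).mul_const (δ.w k)).const_add (θ.w k)
  refine (hw.mul (hrelu k)).congr_deriv ?_
  have : max (preact θ x k) 0 = gate θ x k * preact θ x k := by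
    rcases lt_or_gt_of_ne (hx k) with hk | hk
    · simp [gate, hk.le]
    · simp [gate, hk, hk.le]
  rw [h0, this]
  ring

theorem sum_directional {r n : ℕ} {S : Type*} [Fintype S] (θ δ : Params r n)
    (x : S → EuclideanSpace ℝ (Fin n)) (c : S → ℝ) :
    ∑ s, (∑ k, (gate θ (x s) k * preact θ (x s) k * δ.w k +
        gate θ (x s) k * θ.w k * ((∑ l, x s l * δ.V k l) + δ.b k))) * c s =
      (∑ k, (∑ s, gate θ (x s) k * preact θ (x s) k * c s) * δ.w k) +
        (∑ k, ∑ l, (∑ s, gate θ (x s) k * θ.w k * x s l * c s) * δ.V k l) +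
        ∑ k, (∑ s, gate θ (x s) k * θ.w k * c s) * δ.b k := by
  rw [← Finset.sum_add_distrib, ← Finset.sum_add_distrib]
  simp only [Finset.sum_mul]
  rw [Finset.sum_comm]
  refine Finset.sum_congr rfl fun k _ => ?_
  rw [Finset.sum_comm (s := (Finset.univ : Finset (Fin n))), ← Finset.sum_add_distrib,
    ← Finset.sum_add_distrib]
  refine Finset.sum_congr rfl fun s _ => ?_
  simp only [mul_add, add_mul, Finset.mul_sum, Finset.sum_mul]
  rw [Finset.sum_congr rfl fun l _ => show gate θ (x s) k * θ.w k * (x s l * δ.V k l) * c s =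
    gate θ (x s) k * θ.w k * x s l * c s * δ.V k l by ring]
  ring

/-- Where no pre-activation vanishes, the three families above are minus the gradient of the loss:
the derivative of the loss in any direction `δ` is minus their inner product with `δ`. -/
theorem hasDerivAt_loss_line {r n : ℕ} {I J : Type*} [Fintype I] [Fintype J]
    (xI : I → EuclideanSpace ℝ (Fin n)) (xJ : J → EuclideanSpace ℝ (Fin n)) (θ δ : Params r n)
    (hI : ∀ i k, preact θ (xI i) k ≠ 0) (hJ : ∀ j k, preact θ (xJ j) k ≠ 0) :
    HasDerivAt (fun ε => loss xI xJ (θ.line δ ε))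
      (-((∑ k, negGradW xI xJ θ k * δ.w k) + (∑ k, ∑ l, negGradV xI xJ θ k l * δ.V k l) +
        ∑ k, negGradB xI xJ θ k * δ.b k)) 0 := by
  have h0 : θ.line δ 0 = θ := by simp [Params.line]
  have key : ∀ (f : ℝ → ℝ) (f' : ℝ), HasDerivAt f f' 0 →
      HasDerivAt (fun ε => Real.log (1 + Real.exp (f ε))) (f' * lossWeight (-f 0)) 0 := by
    intro f f' hf
    have := (hf.exp.const_add 1).log (by positivity)
    convert this using 1
    simp only [lossWeight, neg_neg]
    ring
  have h1 := HasDerivAt.fun_sum (u := Finset.univ) fun i _ =>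
    key _ _ (hasDerivAt_network_line θ δ (xI i) (hI i)).neg
  have h2 := HasDerivAt.fun_sum (u := Finset.univ) fun j _ =>
    key _ _ (hasDerivAt_network_line θ δ (xJ j) (hJ j))
  refine (h1.add h2).congr_deriv ?_
  simp only [h0, Pi.neg_apply, neg_neg, neg_mul, Finset.sum_neg_distrib]
  rw [sum_directional, sum_directional]
  simp only [negGradW, negGradV, negGradB, sub_mul, Finset.sum_sub_distrib]
  ring

section GradientFlow

variable {r n : ℕ} {I J : Type*} [Fintype I] [Fintype J]
  (xI : I → EuclideanSpace ℝ (Fin n)) (xJ : J → EuclideanSpace ℝ (Fin n))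

/-- The continuous-time gradient descent `d(w, V, b)/dt = -∇ loss (w, V, b)` on `[0, ∞)`, in its
integrated form, so that the trajectory may cross points where the loss is not differentiable. -/
structure IsGradientFlow (θ : ℝ → Params r n) : Prop where
  continuous_w : ∀ k, ContinuousOn (fun t => (θ t).w k) (Set.Ici 0)
  continuous_V : ∀ k l, ContinuousOn (fun t => (θ t).V k l) (Set.Ici 0)
  continuous_b : ∀ k, ContinuousOn (fun t => (θ t).b k) (Set.Ici 0)
  flow_w : ∀ k, ∀ t, 0 ≤ t →
    IntervalIntegrable (fun τ => negGradW xI xJ (θ τ) k) volume 0 t ∧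
      (θ t).w k = (θ 0).w k + ∫ τ in (0 : ℝ)..t, negGradW xI xJ (θ τ) k
  flow_V : ∀ k l, ∀ t, 0 ≤ t →
    IntervalIntegrable (fun τ => negGradV xI xJ (θ τ) k l) volume 0 t ∧
      (θ t).V k l = (θ 0).V k l + ∫ τ in (0 : ℝ)..t, negGradV xI xJ (θ τ) k l
  flow_b : ∀ k, ∀ t, 0 ≤ t →
    IntervalIntegrable (fun τ => negGradB xI xJ (θ τ) k) volume 0 t ∧
      (θ t).b k = (θ 0).b k + ∫ τ in (0 : ℝ)..t, negGradB xI xJ (θ τ) k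

end GradientFlow

/-- The Frobenius norm. -/
def frobNorm {r n : ℕ} (A : Matrix (Fin r) (Fin n) ℝ) : ℝ := √(∑ k, ∑ l, A k l ^ 2)

/-- Convergence in direction of `(w(t), V(t), b(t))` to `(w̄, V̄, b̄)`: some parameter is unbounded
in norm, the limit is not zero, and `‖W(t) - h(t) W̄‖ / h(t) → 0` for each of the three parameters
and one function `h : [0, ∞) → (0, ∞)` diverging to `+∞`. -/
def ConvergesInDirection {r n : ℕ} (θ : ℝ → Params r n) (θbar : Params r n) : Prop :=
  (Tendsto (fun t => ‖(θ t).w‖) atTop atTop ∨ Tendsto (fun t => frobNorm (θ t).V) atTop atTop ∨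
    Tendsto (fun t => ‖(θ t).b‖) atTop atTop) ∧
  (θbar.w ≠ 0 ∨ θbar.V ≠ 0 ∨ θbar.b ≠ 0) ∧
  ∃ h : ℝ → ℝ, (∀ t, 0 ≤ t → 0 < h t) ∧ Tendsto h atTop atTop ∧
    Tendsto (fun t => ‖(θ t).w - h t • θbar.w‖ / h t) atTop (𝓝 0) ∧
    Tendsto (fun t => frobNorm ((θ t).V - h t • θbar.V) / h t) atTop (𝓝 0) ∧
    Tendsto (fun t => ‖(θ t).b - h t • θbar.b‖ / h t) atTop (𝓝 0)

section SupportVectors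

variable {r n : ℕ} {I J : Type*} [Fintype I] [Fintype J]
  (xI : I → EuclideanSpace ℝ (Fin n)) (xJ : J → EuclideanSpace ℝ (Fin n)) (θ : Params r n)

open Classical in
/-- The (indices of the) support vectors: the points of the first class at which the network takes
the value `1` and the points of the second class at which it takes the value `-1`. -/
def supportVectors : Finset (I ⊕ J) :=
  Finset.univ.filter (Sum.elim (fun i => network θ (xI i) = 1) (fun j => network θ (xJ j) = -1))

open Classical in
/-- The support vectors that activate node `k`. -/
def activeSupport (k : Fin r) : Finset (I ⊕ J) :=
  (supportVectors xI xJ θ).filter (fun s => 0 < preact θ (Sum.elim xI xJ s) k)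

/-- The matrix `X_k`, whose columns are the support vectors activating node `k`. -/
def supportMatrix (k : Fin r) : Matrix (Fin n) (activeSupport xI xJ θ k) ℝ :=
  Matrix.of fun l s => Sum.elim xI xJ s.1 l

open Classical in
/-- The maximum number of support vectors that activate the same node. -/
def nSupMax : ℕ :=
  Finset.univ.sup fun k : Fin r =>
    ((supportVectors xI xJ θ).powerset.filter
      (fun S => ∀ s ∈ S, 0 < preact θ (Sum.elim xI xJ s) k)).sup Finset.card

/-- The minimum cardinality of a set `K` of nodes such that every support vector activates at least
one node of `K`. -/
def nNodeMin : ℕ :=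
  sInf {m : ℕ | ∃ K : Finset (Fin r), K.card = m ∧
    ∀ s ∈ supportVectors xI xJ θ, ∃ k ∈ K, 0 < preact θ (Sum.elim xI xJ s) k}

end SupportVectors

end TwoLayerReLU

end

/-!
The gradient flow preserves `w_k² - ‖V_k‖² - b_k²` for each node (the ReLU is homogeneous, and the
integrated flow equation makes the parameters absolutely continuous), so the limit is balanced:
`w̄_k² = ‖V̄_k‖² + b̄_k²` (`IsGradientFlow.balance_limit`). Hence the limit network is Lipschitz with
constant `∑ |w̄_k| ‖V̄_k‖ ≤ ‖w̄‖²` (`lipschitzWith_network`), and it remains to bound `‖w̄‖²`.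

This is done through asymptotic Karush–Kuhn–Tucker conditions
(`IsGradientFlow.exists_multipliers`). Let `g(t) = ⟪w̄, w(t)⟫ / ‖w̄‖²`; the parameters divided by
`g` tend to the limit. Let `ℓ_s` be the loss weight of the point `x_s` and
`α_s(t) = (∫ g ℓ_s) / g(t)`.
The margin of `x_s` is about `g²` times its limit margin, so the `ℓ_s` of points that are not support
vectors are negligible against those of support vectors. Along the flow, `⟪w̄, w⟫` has derivative
`∑_s y_s ℓ_s ∑_k w̄_k (V_k x_s + b_k)₊ ≈ g ∑_{s sup} ℓ_s`. This bounds the averages `α_s` and yields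
`∑_{s sup} α_s → ‖w̄‖²`. Since the gates of the support vectors at nodes with `w̄_k ≠ 0` are
eventually constant, the equation for `V_k` likewise yields `∑ y_s α_s x_s → V̄_k / w̄_k`, the sum
being over the support vectors that activate node `k`.

The vectors `V̄_k / w̄_k` have norm at most `1`, so the eigenvalue bound for `X_kᵀ X_k` and the
Cauchy–Schwarz inequality bound the sum of the `α_s` at node `k` by `√(n_sup^max / λ)` up to an
arbitrarily small error (`sum_multipliers_le`). Covering the support vectors by `n_node^min` nodes
bounds `‖w̄‖²`. Nodes with `w̄_k = 0` vanish identically by balance and activate no support vector.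
-/

open MeasureTheory Filter Topology

namespace TwoLayerReLU

/-! ### Primitives of integrable functions -/

theorem intervalIntegrable_of_nonneg {φ : ℝ → ℝ}
    (hφ : ∀ t, 0 ≤ t → IntervalIntegrable φ volume 0 t) {a b : ℝ} (ha : 0 ≤ a) (hb : 0 ≤ b) :
    IntervalIntegrable φ volume a b :=
  (hφ a ha).symm.trans (hφ b hb)

theorem sub_eq_integral_of_primitive {f φ : ℝ → ℝ}
    (hf : ∀ t, 0 ≤ t → IntervalIntegrable φ volume 0 t ∧ f t = f 0 + ∫ τ in (0 : ℝ)..t, φ τ)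
    {a b : ℝ} (ha : 0 ≤ a) (hb : 0 ≤ b) : f b - f a = ∫ τ in a..b, φ τ := by
  rw [(hf a ha).2, (hf b hb).2,
    ← intervalIntegral.integral_interval_sub_left (hf b hb).1 (hf a ha).1]
  ring

/-- The chain rule for the square of the primitive of a merely integrable function, which is
absolutely continuous. -/
theorem sq_sub_sq_eq_integral_of_primitive {f φ : ℝ → ℝ}
    (hf : ∀ t, 0 ≤ t → IntervalIntegrable φ volume 0 t ∧ f t = f 0 + ∫ τ in (0 : ℝ)..t, φ τ)
    {t : ℝ} (ht : 0 ≤ t) :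
    IntervalIntegrable (fun τ => 2 * (f τ * φ τ)) volume 0 t ∧
      f t ^ 2 - f 0 ^ 2 = ∫ τ in (0 : ℝ)..t, 2 * (f τ * φ τ) := by
  have hφ := (hf t ht).1
  have hmem : ∀ x ∈ Set.uIcc 0 t, f x = f 0 + ∫ τ in (0 : ℝ)..x, φ τ := fun x hx =>
    (hf x (by rw [Set.uIcc_of_le ht] at hx; exact hx.1)).2
  set F : ℝ → ℝ := fun x => f 0 + ∫ τ in (0 : ℝ)..x, φ τ with hF
  have hAC : AbsolutelyContinuousOnInterval F 0 t :=
    (LipschitzWith.const (f 0)).lipschitzOnWith.absolutelyContinuousOnInterval.add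
      (hφ.absolutelyContinuousOnInterval_intervalIntegral (c := 0) Set.left_mem_uIcc)
  have hcongr : ∀ᵐ x, x ∈ Set.uIoc 0 t →
      deriv F x * F x + F x * deriv F x = 2 * (f x * φ x) := by
    filter_upwards [hφ.ae_hasDerivAt_integral] with x hx hxt
    have hxt' := Set.uIoc_subset_uIcc hxt
    rw [((hx hxt' 0 Set.left_mem_uIcc).const_add (f 0)).deriv, hmem x hxt']
    simp only [hF]
    ring
  constructor
  · have hc : ContinuousOn f (Set.uIcc 0 t) := hAC.continuousOn.congr hmem
    exact (hφ.continuousOn_mul hc).const_mul 2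
  · rw [← intervalIntegral.integral_congr_ae hcongr, hAC.integral_deriv_mul_eq_sub hAC]
    have h1 : F t = f t := (hmem t Set.right_mem_uIcc).symm
    have h2 : F 0 = f 0 := (hmem 0 Set.left_mem_uIcc).symm
    rw [h1, h2]
    ring

/-- An integrand that is negligible against `m` has an integral negligible against `g`, when
`g` diverges and dominates the integral of `m`. -/
theorem tendsto_integral_div_of_isLittleO {φ m g : ℝ → ℝ} {T C : ℝ}
    (hg : Tendsto g atTop atTop)
    (hφ : ∀ t, T ≤ t → IntervalIntegrable φ volume T t)
    (hm : ∀ t, T ≤ t → IntervalIntegrable m volume T t) (hm0 : ∀ t, T ≤ t → 0 ≤ m t)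
    (hC : ∀ t, T ≤ t → ∫ τ in T..t, m τ ≤ C * g t) (hφm : φ =o[atTop] m) :
    Tendsto (fun t => (∫ τ in T..t, φ τ) / g t) atTop (𝓝 0) := by
  rw [Metric.tendsto_nhds]
  intro ε hε
  set δ := ε / (2 * (|C| + 1)) with hδ
  have hδ0 : 0 < δ := by positivity
  obtain ⟨T₁, hT₁⟩ := eventually_atTop.1 ((hφm.def hδ0).and (eventually_ge_atTop T))
  have hTT : T ≤ T₁ := (hT₁ T₁ le_rfl).2
  set A := ∫ τ in T..T₁, φ τ
  have hA : Tendsto (fun t => |A| / g t) atTop (𝓝 0) := tendsto_const_nhds.div_atTop hg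
  filter_upwards [hA.eventually_lt_const (half_pos hε), hg.eventually_gt_atTop 0,
    eventually_ge_atTop T₁] with t hAt hgt ht
  have hTt := hTT.trans ht
  have hφ₁ : IntervalIntegrable φ volume T₁ t := (hφ _ hTT).symm.trans (hφ _ hTt)
  have hm₁ : IntervalIntegrable m volume T₁ t := (hm _ hTT).symm.trans (hm _ hTt)
  have h1 : |∫ τ in T₁..t, φ τ| ≤ δ * (|C| * g t) := by
    calc |∫ τ in T₁..t, φ τ| ≤ ∫ τ in T₁..t, δ * m τ := by
          rw [← Real.norm_eq_abs]
          refine intervalIntegral.norm_integral_le_of_norm_le ht ?_ (hm₁.const_mul δ)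
          refine Eventually.of_forall fun τ hτ => ?_
          have := (hT₁ τ hτ.1.le).1
          rwa [Real.norm_of_nonneg (hm0 τ (hTT.trans hτ.1.le))] at this
      _ = δ * ∫ τ in T₁..t, m τ := intervalIntegral.integral_const_mul _ _
      _ ≤ δ * (|C| * g t) := by
          refine mul_le_mul_of_nonneg_left ?_ hδ0.le
          have h2 := intervalIntegral.integral_add_adjacent_intervals (hm _ hTT) hm₁
          have h3 : 0 ≤ ∫ τ in T..T₁, m τ :=
            intervalIntegral.integral_nonneg hTT fun τ hτ => hm0 τ hτ.1
          have h4 := hC t hTt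
          have h5 : C * g t ≤ |C| * g t := mul_le_mul_of_nonneg_right (le_abs_self C) hgt.le
          linarith
  have h6 : δ * (|C| * g t) ≤ ε / 2 * g t := by
    have : δ * |C| ≤ ε / 2 := by
      rw [hδ, div_mul_eq_mul_div, div_le_div_iff₀ (by positivity) (by norm_num)]
      nlinarith [abs_nonneg C]
    nlinarith
  rw [dist_zero_right, Real.norm_eq_abs, abs_div, abs_of_pos hgt, div_lt_iff₀ hgt,
    ← intervalIntegral.integral_add_adjacent_intervals (hφ _ hTT) hφ₁]
  rw [div_lt_iff₀ hgt] at hAt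
  have := abs_add_le A (∫ τ in T₁..t, φ τ)
  linarith

/-! ### The weight `e^{-z} / (1 + e^{-z})` -/

theorem lossWeight_pos (z : ℝ) : 0 < lossWeight z := by unfold lossWeight; positivity

theorem continuous_lossWeight : Continuous lossWeight := by
  unfold lossWeight
  exact (by fun_prop : Continuous fun z : ℝ => Real.exp (-z)).div (by fun_prop)
    fun z => by positivity

theorem lossWeight_le_exp (z : ℝ) : lossWeight z ≤ Real.exp (-z) :=
  div_le_self (by positivity) (by linarith [Real.exp_pos (-z)])

theorem exp_le_two_mul_lossWeight {z : ℝ} (hz : 0 ≤ z) : Real.exp (-z) ≤ 2 * lossWeight z := by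
  have h : Real.exp (-z) ≤ 1 := Real.exp_le_one_iff.2 (by linarith)
  unfold lossWeight
  rw [← mul_div_assoc, le_div_iff₀ (by positivity)]
  nlinarith [Real.exp_pos (-z)]

theorem lossWeight_isLittleO {z z' : ℝ → ℝ} (hz' : ∀ᶠ t in atTop, 0 ≤ z' t)
    (h : Tendsto (fun t => z t - z' t) atTop atTop) :
    (fun t => lossWeight (z t)) =o[atTop] fun t => lossWeight (z' t) := by
  rw [Asymptotics.isLittleO_iff]
  intro c hc
  filter_upwards [hz', h.eventually_ge_atTop (-Real.log (c / 2))] with t h1 h2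
  rw [Real.norm_of_nonneg (lossWeight_pos _).le, Real.norm_of_nonneg (lossWeight_pos _).le]
  calc lossWeight (z t) ≤ Real.exp (-z t) := lossWeight_le_exp _
    _ = Real.exp (-(z t - z' t)) * Real.exp (-z' t) := by rw [← Real.exp_add]; ring_nf
    _ ≤ (c / 2) * (2 * lossWeight (z' t)) := by
        refine mul_le_mul ?_ (exp_le_two_mul_lossWeight h1) (by positivity) (by positivity)
        calc Real.exp (-(z t - z' t)) ≤ Real.exp (Real.log (c / 2)) :=
              Real.exp_le_exp.2 (by linarith)
          _ = c / 2 := Real.exp_log (by positivity)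
    _ = c * lossWeight (z' t) := by ring

/-! ### Gram matrices -/

theorem mul_sum_sq_le_of_gram_eigenvalues {m ι : Type*} [Fintype m] [Fintype ι]
    (X : Matrix m ι ℝ) {lam : ℝ}
    (h : ∀ μ : ℝ, Module.End.HasEigenvalue (Matrix.mulVecLin (X.transpose * X)) μ → lam ≤ μ)
    (v : ι → ℝ) : lam * ∑ i, v i ^ 2 ≤ ∑ j, (X.mulVec v j) ^ 2 := by
  classical
  have hG : (X.transpose * X).IsHermitian := by
    simpa using Matrix.isHermitian_conjTranspose_mul_self X
  have hM : (X.transpose * X - lam • (1 : Matrix ι ι ℝ)).IsHermitian := by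
    refine hG.sub ?_
    simp [Matrix.IsHermitian]
  have hpos : (X.transpose * X - lam • (1 : Matrix ι ι ℝ)).PosSemidef := by
    rw [hM.posSemidef_iff_eigenvalues_nonneg]
    intro i
    have hi := hM.mulVec_eigenvectorBasis i
    set u : EuclideanSpace ℝ ι := hM.eigenvectorBasis i with hu
    have hu0 : (u : ι → ℝ) ≠ 0 := by
      intro h0
      exact hM.eigenvectorBasis.orthonormal.ne_zero i (by ext j; simpa using congrFun h0 j)
    rw [Matrix.sub_mulVec, Matrix.smul_mulVec, Matrix.one_mulVec, sub_eq_iff_eq_add,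
      ← add_smul] at hi
    have := h _ (Module.End.hasEigenvalue_of_hasEigenvector
      ⟨Module.End.mem_eigenspace_iff.2 ((Matrix.mulVecLin_apply _ _).trans hi), hu0⟩)
    simpa using this
  have hv := hpos.dotProduct_mulVec_nonneg v
  rw [Matrix.sub_mulVec, Matrix.smul_mulVec, Matrix.one_mulVec, dotProduct_sub, star_trivial,
    dotProduct_smul, ← Matrix.mulVec_mulVec, Matrix.dotProduct_mulVec,
    Matrix.vecMul_transpose] at hv
  simp only [dotProduct, smul_eq_mul, ← sq] at hv
  linarith

/-! ### Limits of the rescaled trajectory -/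

/-- Coordinatewise form of convergence in direction: `θ(t) / g(t)` tends to `θbar` and the scale
`g` diverges. -/
structure HasScaledLimit {r n : ℕ} (θ : ℝ → Params r n) (g : ℝ → ℝ) (θbar : Params r n) :
    Prop where
  scale : Tendsto g atTop atTop
  w : ∀ k, Tendsto (fun t => (θ t).w k / g t) atTop (𝓝 (θbar.w k))
  V : ∀ k l, Tendsto (fun t => (θ t).V k l / g t) atTop (𝓝 (θbar.V k l))
  b : ∀ k, Tendsto (fun t => (θ t).b k / g t) atTop (𝓝 (θbar.b k))

theorem tendsto_div_of_abs_sub_le {f h N : ℝ → ℝ} {c : ℝ} (hh : Tendsto h atTop atTop)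
    (hN : Tendsto (fun t => N t / h t) atTop (𝓝 0)) (hle : ∀ t, |f t - h t * c| ≤ N t) :
    Tendsto (fun t => f t / h t) atTop (𝓝 c) := by
  rw [tendsto_iff_norm_sub_tendsto_zero]
  refine squeeze_zero' (Eventually.of_forall fun t => norm_nonneg _) ?_ hN
  filter_upwards [hh.eventually_gt_atTop 0] with t ht
  have : f t / h t - c = (f t - h t * c) / h t := by field_simp
  rw [this, Real.norm_eq_abs, abs_div, abs_of_pos ht]
  gcongr
  exact hle t

theorem abs_apply_le_frobNorm {r n : ℕ} (A : Matrix (Fin r) (Fin n) ℝ) (k : Fin r) (l : Fin n) :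
    |A k l| ≤ frobNorm A := by
  refine Real.abs_le_sqrt ?_
  calc A k l ^ 2 ≤ ∑ l, A k l ^ 2 :=
        Finset.single_le_sum (f := fun l => A k l ^ 2) (fun _ _ => sq_nonneg _)
          (Finset.mem_univ l)
    _ ≤ ∑ k, ∑ l, A k l ^ 2 :=
        Finset.single_le_sum (f := fun k => ∑ l, A k l ^ 2)
          (fun _ _ => Finset.sum_nonneg fun _ _ => sq_nonneg _) (Finset.mem_univ k)

theorem ConvergesInDirection.exists_hasScaledLimit {r n : ℕ} {θ : ℝ → Params r n}
    {θbar : Params r n} (h : ConvergesInDirection θ θbar) : ∃ g, HasScaledLimit θ g θbar := by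
  obtain ⟨-, -, g, -, hg, hw, hV, hb⟩ := h
  refine ⟨g, hg, fun k => ?_, fun k l => ?_, fun k => ?_⟩
  · exact tendsto_div_of_abs_sub_le hg hw fun t => by
      simpa using PiLp.norm_apply_le ((θ t).w - g t • θbar.w) k
  · exact tendsto_div_of_abs_sub_le hg hV fun t => by
      simpa using abs_apply_le_frobNorm ((θ t).V - g t • θbar.V) k l
  · exact tendsto_div_of_abs_sub_le hg hb fun t => by
      simpa using PiLp.norm_apply_le ((θ t).b - g t • θbar.b) k

section Scaled

variable {r n : ℕ} {θ : ℝ → Params r n} {g : ℝ → ℝ} {θbar : Params r n}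

theorem HasScaledLimit.congr_scale {h : ℝ → ℝ} (H : HasScaledLimit θ h θbar)
    (hgh : Tendsto (fun t => g t / h t) atTop (𝓝 1)) : HasScaledLimit θ g θbar := by
  have h0 : ∀ᶠ t in atTop, h t ≠ 0 := (H.scale.eventually_gt_atTop 0).mono fun t ht => ht.ne'
  have key : ∀ (f : ℝ → ℝ) (c : ℝ), Tendsto (fun t => f t / h t) atTop (𝓝 c) →
      Tendsto (fun t => f t / g t) atTop (𝓝 c) := by
    intro f c hf
    have := hf.div hgh one_ne_zero
    rw [div_one] at this
    refine this.congr' ?_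
    filter_upwards [h0] with t ht
    exact div_div_div_cancel_right₀ ht _ _
  refine ⟨?_, fun k => key _ _ (H.w k), fun k l => key _ _ (H.V k l), fun k => key _ _ (H.b k)⟩
  refine (hgh.pos_mul_atTop one_pos H.scale).congr' ?_
  filter_upwards [h0] with t ht
  exact div_mul_cancel₀ _ ht

/-- The normalized overlap of the output weights with their limit direction. Unlike the scale in
the definition of convergence in direction, it is a continuous function of time, and its increments
are integrals along the gradient flow. -/
noncomputable def overlap (θbar θ : Params r n) : ℝ :=
  (∑ k, θbar.w k * θ.w k) / ∑ k, θbar.w k ^ 2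

theorem HasScaledLimit.overlap {h : ℝ → ℝ} (H : HasScaledLimit θ h θbar)
    (hw : ∑ k, θbar.w k ^ 2 ≠ 0) : HasScaledLimit θ (fun t => overlap θbar (θ t)) θbar := by
  refine H.congr_scale ?_
  have h1 : Tendsto (fun t => (∑ k, θbar.w k * ((θ t).w k / h t)) / ∑ k, θbar.w k ^ 2) atTop
      (𝓝 ((∑ k, θbar.w k * θbar.w k) / ∑ k, θbar.w k ^ 2)) :=
    (tendsto_finsetSum _ fun k _ => (H.w k).const_mul (θbar.w k)).div_const _
  simp only [← sq, div_self hw] at h1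
  refine h1.congr fun t => ?_
  rw [TwoLayerReLU.overlap, div_right_comm, Finset.sum_div _ _ (h t)]
  simp only [mul_div_assoc]

namespace HasScaledLimit

theorem preact (H : HasScaledLimit θ g θbar) (x : EuclideanSpace ℝ (Fin n))
    (k : Fin r) :
    Tendsto (fun t => preact (θ t) x k / g t) atTop (𝓝 (preact θbar x k)) := by
  refine ((tendsto_finsetSum Finset.univ fun l _ => (H.V k l).mul_const (x l)).add
    (H.b k)).congr fun t => ?_
  rw [TwoLayerReLU.preact, add_div, Finset.sum_div]
  simp only [div_mul_eq_mul_div]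

theorem relu (H : HasScaledLimit θ g θbar) (x : EuclideanSpace ℝ (Fin n))
    (k : Fin r) :
    Tendsto (fun t => max (TwoLayerReLU.preact (θ t) x k) 0 / g t) atTop
      (𝓝 (max (TwoLayerReLU.preact θbar x k) 0)) := by
  refine ((H.preact x k).max tendsto_const_nhds).congr' ?_
  filter_upwards [H.scale.eventually_gt_atTop 0] with t ht
  rw [← max_div_div_right ht.le, zero_div]

theorem network (H : HasScaledLimit θ g θbar) (x : EuclideanSpace ℝ (Fin n)) :
    Tendsto (fun t => network (θ t) x / g t ^ 2) atTop (𝓝 (network θbar x)) := by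
  refine (tendsto_finsetSum Finset.univ fun k _ => (H.w k).mul (H.relu x k)).congr fun t => ?_
  rw [TwoLayerReLU.network, Finset.sum_div]
  exact Finset.sum_congr rfl fun k _ => by rw [div_mul_div_comm, ← sq]

theorem gate_eventually_eq_one (H : HasScaledLimit θ g θbar) (x : EuclideanSpace ℝ (Fin n))
    {k : Fin r} (hk : 0 < TwoLayerReLU.preact θbar x k) :
    ∀ᶠ t in atTop, gate (θ t) x k = 1 := by
  filter_upwards [(H.preact x k).eventually_const_lt hk, H.scale.eventually_gt_atTop 0]
    with t h1 h2
  exact if_pos ((div_pos_iff_of_pos_right h2).1 h1)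

theorem preact_eventually_nonpos (H : HasScaledLimit θ g θbar) (x : EuclideanSpace ℝ (Fin n))
    {k : Fin r} (hk : TwoLayerReLU.preact θbar x k < 0) :
    ∀ᶠ t in atTop, TwoLayerReLU.preact (θ t) x k ≤ 0 := by
  filter_upwards [(H.preact x k).eventually_lt_const hk, H.scale.eventually_gt_atTop 0]
    with t h1 h2
  exact ((div_lt_iff₀ h2).1 h1).le.trans_eq (zero_mul _)

end HasScaledLimit

end Scaled

/-! ### The gradient as a sum over all labelled points -/

theorem gate_mul_preact {r n : ℕ} (θ : Params r n) (x : EuclideanSpace ℝ (Fin n)) (k : Fin r) :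
    gate θ x k * preact θ x k = max (preact θ x k) 0 := by
  unfold gate
  split_ifs with h
  · rw [one_mul, max_eq_left h.le]
  · rw [zero_mul, max_eq_right (not_lt.1 h)]

/-- The label of a training point: `1` on the first class, `-1` on the second. -/
def label {I J : Type*} : I ⊕ J → ℝ := Sum.elim (fun _ => 1) (fun _ => -1)

theorem label_mul_self {I J : Type*} (s : I ⊕ J) : label s * label s = 1 := by
  rcases s with i | j <;> simp [label]

section Points

variable {r n : ℕ} {I J : Type*} [Fintype I] [Fintype J]
  (xI : I → EuclideanSpace ℝ (Fin n)) (xJ : J → EuclideanSpace ℝ (Fin n))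

/-- The classification margin `y_s · wᵀ (V x_s + b)₊` of the training point `s`. -/
def margin (θ : Params r n) (s : I ⊕ J) : ℝ := label s * network θ (Sum.elim xI xJ s)

theorem negGradW_eq_sum (θ : Params r n) (k : Fin r) :
    negGradW xI xJ θ k = ∑ s, label s * max (preact θ (Sum.elim xI xJ s) k) 0 *
      lossWeight (margin xI xJ θ s) := by
  simp only [negGradW, Fintype.sum_sum_type, margin, label, Sum.elim_inl, Sum.elim_inr,
    gate_mul_preact, one_mul, neg_mul, Finset.sum_neg_distrib, sub_eq_add_neg]

theorem negGradV_eq_sum (θ : Params r n) (k : Fin r) (l : Fin n) :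
    negGradV xI xJ θ k l = ∑ s, label s * Sum.elim xI xJ s l *
      (gate θ (Sum.elim xI xJ s) k * θ.w k) * lossWeight (margin xI xJ θ s) := by
  simp only [negGradV, Fintype.sum_sum_type, margin, label, Sum.elim_inl, Sum.elim_inr,
    one_mul, neg_mul, Finset.sum_neg_distrib, sub_eq_add_neg,
    mul_comm (xI _ l), mul_comm (xJ _ l)]

theorem sum_balance {S : Type*} [Fintype S] (θ : Params r n) (k : Fin r)
    (x : S → EuclideanSpace ℝ (Fin n)) (c : S → ℝ) :
    (∑ l, θ.V k l * ∑ s, gate θ (x s) k * θ.w k * x s l * c s) +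
        θ.b k * ∑ s, gate θ (x s) k * θ.w k * c s =
      θ.w k * ∑ s, gate θ (x s) k * preact θ (x s) k * c s := by
  simp only [Finset.mul_sum]
  rw [Finset.sum_comm, ← Finset.sum_add_distrib]
  refine Finset.sum_congr rfl fun s _ => ?_
  have : ∀ l, θ.V k l * (gate θ (x s) k * θ.w k * x s l * c s) =
      (gate θ (x s) k * θ.w k * c s) * (θ.V k l * x s l) := fun l => by ring
  simp only [this, ← Finset.mul_sum, preact]
  ring

/-- Homogeneity of the ReLU: the incoming and the outgoing weights of a node have the same inner
product with their gradients. -/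
theorem negGrad_balance (θ : Params r n) (k : Fin r) :
    θ.w k * negGradW xI xJ θ k =
      (∑ l, θ.V k l * negGradV xI xJ θ k l) + θ.b k * negGradB xI xJ θ k := by
  have hI := sum_balance θ k xI fun i => lossWeight (network θ (xI i))
  have hJ := sum_balance θ k xJ fun j => lossWeight (-network θ (xJ j))
  simp only [negGradW, negGradV, negGradB, mul_sub, Finset.sum_sub_distrib]
  linarith

end Points

/-! ### Averages along the flow -/

theorem sub_const_mul_isLittleO {f g : ℝ → ℝ} {c : ℝ} (hg : ∀ᶠ t in atTop, g t ≠ 0)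
    (h : Tendsto (fun t => f t / g t) atTop (𝓝 c)) :
    (fun t => f t - c * g t) =o[atTop] g := by
  rw [Asymptotics.isLittleO_iff_tendsto' (hg.mono fun t ht h0 => absurd h0 ht)]
  have := h.sub_const c
  rw [sub_self] at this
  refine this.congr' ?_
  filter_upwards [hg] with t ht
  rw [sub_div, mul_div_cancel_right₀ _ ht]

/-- If `f` grows like `c · g` and its derivative is, up to a negligible error, the combination of
the `g · p s` with coefficients `d s`, then the same combination of the averages
`(∫ g · p s) / g` tends to `c`. -/
theorem tendsto_sum_mul_average {S : Type*} [Fintype S] {f φ g : ℝ → ℝ} {p : S → ℝ → ℝ}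
    {T C c : ℝ} {d : S → ℝ} (hT : 0 ≤ T) (hg : Tendsto g atTop atTop)
    (hf : ∀ t, 0 ≤ t → IntervalIntegrable φ volume 0 t ∧ f t = f 0 + ∫ τ in (0 : ℝ)..t, φ τ)
    (hgc : ContinuousOn g (Set.Ici 0)) (hpc : ∀ s, ContinuousOn (p s) (Set.Ici 0))
    (hp0 : ∀ s t, 0 ≤ p s t) (hgT : ∀ t, T ≤ t → 0 < g t)
    (hC : ∀ t, T ≤ t → ∫ τ in T..t, g τ * ∑ s, p s τ ≤ C * g t)
    (hfc : Tendsto (fun t => f t / g t) atTop (𝓝 c))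
    (ho : (fun τ => φ τ - ∑ s, d s * (g τ * p s τ)) =o[atTop] fun τ => g τ * ∑ s, p s τ) :
    Tendsto (fun t => ∑ s, d s * ((∫ τ in T..t, g τ * p s τ) / g t)) atTop (𝓝 c) := by
  have hsub : ∀ {t}, T ≤ t → Set.uIcc T t ⊆ Set.Ici 0 := fun {t} ht => by
    rw [Set.uIcc_of_le ht]
    exact fun x hx => hT.trans hx.1
  have hint : ∀ t, T ≤ t → ∀ s, IntervalIntegrable (fun τ => g τ * p s τ) volume T t :=
    fun t ht s => ((hgc.mul (hpc s)).mono (hsub ht)).intervalIntegrable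
  have hsum : ∀ t, T ≤ t →
      IntervalIntegrable (fun τ => ∑ s, d s * (g τ * p s τ)) volume T t := fun t ht => by
    refine ContinuousOn.intervalIntegrable ?_
    exact (continuousOn_finsetSum _ fun s _ =>
      continuousOn_const.mul (hgc.mul (hpc s))).mono (hsub ht)
  have hφ : ∀ t, T ≤ t → IntervalIntegrable φ volume T t := fun t ht =>
    intervalIntegrable_of_nonneg (fun t ht => (hf t ht).1) hT (hT.trans ht)
  have herr := tendsto_integral_div_of_isLittleO hg (fun t ht => (hφ t ht).sub (hsum t ht))
    (fun t ht => ((hgc.mul (continuousOn_finsetSum _ fun s _ => hpc s)).mono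
      (hsub ht)).intervalIntegrable)
    (fun t ht => mul_nonneg (hgT t ht).le (Finset.sum_nonneg fun s _ => hp0 s t)) hC ho
  have hlim := (hfc.sub ((tendsto_const_nhds (x := f T)).div_atTop hg)).sub herr
  rw [sub_zero, sub_zero] at hlim
  refine hlim.congr' ?_
  filter_upwards [eventually_ge_atTop T] with t ht
  rw [intervalIntegral.integral_sub (hφ t ht) (hsum t ht),
    ← sub_eq_integral_of_primitive hf hT (hT.trans ht),
    intervalIntegral.integral_finsetSum fun s _ => (hint t ht s).const_mul (d s)]
  simp only [intervalIntegral.integral_const_mul, ← mul_div_assoc, ← Finset.sum_div]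
  ring

/-! ### Decay of the loss weights -/

theorem HasScaledLimit.margin {r n : ℕ} {I J : Type*}
    {xI : I → EuclideanSpace ℝ (Fin n)} {xJ : J → EuclideanSpace ℝ (Fin n)}
    {θ : ℝ → Params r n} {θbar : Params r n} {g : ℝ → ℝ} (H : HasScaledLimit θ g θbar) (s : I ⊕ J) :
    Tendsto (fun t => margin xI xJ (θ t) s / g t ^ 2) atTop (𝓝 (margin xI xJ θbar s)) := by
  simpa only [TwoLayerReLU.margin, mul_div_assoc] using (H.network _).const_mul (label s)

/-- The margins are quadratic in the scale, so the weight `e^{-margin}` of a point whose limit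
margin exceeds `1` is negligible against that of a support vector. -/
theorem HasScaledLimit.lossWeight_isLittleO {r n : ℕ} {I J : Type*}
    {xI : I → EuclideanSpace ℝ (Fin n)} {xJ : J → EuclideanSpace ℝ (Fin n)}
    {θ : ℝ → Params r n} {θbar : Params r n} {g : ℝ → ℝ} (H : HasScaledLimit θ g θbar)
    {s s' : I ⊕ J} (hs : 1 < TwoLayerReLU.margin xI xJ θbar s)
    (hs' : TwoLayerReLU.margin xI xJ θbar s' = 1) :
    (fun t => lossWeight (TwoLayerReLU.margin xI xJ (θ t) s)) =o[atTop]
      fun t => lossWeight (TwoLayerReLU.margin xI xJ (θ t) s') := by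
  have hg2 : Tendsto (fun t => g t ^ 2) atTop atTop :=
    (tendsto_pow_atTop two_ne_zero).comp H.scale
  have hg0 : ∀ᶠ t in atTop, 0 < g t ^ 2 := hg2.eventually_gt_atTop 0
  apply TwoLayerReLU.lossWeight_isLittleO
  · have := (H.margin (xI := xI) (xJ := xJ) s').eventually_const_lt (hs'.symm ▸ zero_lt_one)
    filter_upwards [this, hg0] with t h1 h2
    exact ((div_pos_iff_of_pos_right h2).1 h1).le
  · have := ((H.margin s).sub (H.margin s')).pos_mul_atTop
      (by rw [hs']; linarith) hg2
    refine this.congr' ?_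
    filter_upwards [hg0] with t h
    rw [← sub_div, div_mul_cancel₀ _ h.ne']

section Flow

variable {r n : ℕ} {I J : Type*} [Fintype I] [Fintype J]
  {xI : I → EuclideanSpace ℝ (Fin n)} {xJ : J → EuclideanSpace ℝ (Fin n)}
  {θ : ℝ → Params r n} {θbar : Params r n}

/-! ### Balance of incoming and outgoing weights -/

namespace IsGradientFlow

theorem balance (hflow : IsGradientFlow xI xJ θ) (k : Fin r) {t : ℝ} (ht : 0 ≤ t) :
    (θ t).w k ^ 2 - (∑ l, (θ t).V k l ^ 2) - (θ t).b k ^ 2 =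
      (θ 0).w k ^ 2 - (∑ l, (θ 0).V k l ^ 2) - (θ 0).b k ^ 2 := by
  have hw := sq_sub_sq_eq_integral_of_primitive (hflow.flow_w k) ht
  have hV := fun l => sq_sub_sq_eq_integral_of_primitive (hflow.flow_V k l) ht
  have hb := sq_sub_sq_eq_integral_of_primitive (hflow.flow_b k) ht
  have hsum : ∑ l, ((θ t).V k l ^ 2 - (θ 0).V k l ^ 2) = ∫ τ in (0 : ℝ)..t,
      ∑ l, 2 * ((θ τ).V k l * negGradV xI xJ (θ τ) k l) := by
    rw [intervalIntegral.integral_finsetSum fun l _ => (hV l).1]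
    exact Finset.sum_congr rfl fun l _ => (hV l).2
  have hVi : IntervalIntegrable
      (fun τ => ∑ l, 2 * ((θ τ).V k l * negGradV xI xJ (θ τ) k l)) volume 0 t := by
    simpa only [Finset.sum_fn] using! IntervalIntegrable.sum Finset.univ fun l _ => (hV l).1
  have h : (θ t).w k ^ 2 - (θ 0).w k ^ 2 =
      ∑ l, ((θ t).V k l ^ 2 - (θ 0).V k l ^ 2) + ((θ t).b k ^ 2 - (θ 0).b k ^ 2) := by
    rw [hw.2, hsum, hb.2, ← intervalIntegral.integral_add hVi hb.1]
    refine intervalIntegral.integral_congr fun τ _ => ?_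
    simp only [negGrad_balance, mul_add, Finset.mul_sum]
  rw [Finset.sum_sub_distrib] at h
  linarith

theorem balance_limit (hflow : IsGradientFlow xI xJ θ) {g : ℝ → ℝ}
    (H : HasScaledLimit θ g θbar) (k : Fin r) :
    θbar.w k ^ 2 = (∑ l, θbar.V k l ^ 2) + θbar.b k ^ 2 := by
  have h1 := (((H.w k).pow 2).sub (tendsto_finsetSum Finset.univ fun l _ =>
    (H.V k l).pow 2)).sub ((H.b k).pow 2)
  have h2 : Tendsto (fun t => ((θ 0).w k ^ 2 - (∑ l, (θ 0).V k l ^ 2) - (θ 0).b k ^ 2) / g t ^ 2)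
      atTop (𝓝 0) :=
    tendsto_const_nhds.div_atTop ((tendsto_pow_atTop two_ne_zero).comp H.scale)
  have h3 := tendsto_nhds_unique h1 (h2.congr' ?_)
  · linarith
  · filter_upwards [eventually_ge_atTop 0] with t ht
    rw [← hflow.balance k ht]
    simp only [div_pow, sub_div, Finset.sum_div]

/-! ### Continuity along the flow -/

theorem continuousOn_network (hflow : IsGradientFlow xI xJ θ) (x : EuclideanSpace ℝ (Fin n)) :
    ContinuousOn (fun t => network (θ t) x) (Set.Ici 0) := by
  unfold network preact
  exact continuousOn_finsetSum _ fun k _ => (hflow.continuous_w k).mul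
    (((continuousOn_finsetSum _ fun l _ => (hflow.continuous_V k l).mul
      continuousOn_const).add (hflow.continuous_b k)).sup continuousOn_const)

theorem continuousOn_lossWeight (hflow : IsGradientFlow xI xJ θ) (s : I ⊕ J) :
    ContinuousOn (fun t => lossWeight (margin xI xJ (θ t) s)) (Set.Ici 0) :=
  continuous_lossWeight.comp_continuousOn
    (continuousOn_const.mul (hflow.continuousOn_network _))

theorem continuousOn_overlap (hflow : IsGradientFlow xI xJ θ) :
    ContinuousOn (fun t => overlap θbar (θ t)) (Set.Ici 0) := by
  unfold overlap
  exact (continuousOn_finsetSum _ fun k _ =>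
    continuousOn_const.mul (hflow.continuous_w k)).div_const _

end IsGradientFlow

/-! ### Asymptotic multipliers -/

theorem mem_supportVectors_iff (s : I ⊕ J) :
    s ∈ supportVectors xI xJ θbar ↔ margin xI xJ θbar s = 1 := by
  rcases s with i | j
  · simp [supportVectors, margin, label]
  · simp [supportVectors, margin, label, neg_eq_iff_eq_neg]

/-- A coefficient of order `g` suffices for the weight of a point that is not a support vector to
be negligible against `g` times the total weight; at a support vector it has to be `o(g)`. -/
theorem HasScaledLimit.mul_lossWeight_isLittleO {g c : ℝ → ℝ} (H : HasScaledLimit θ g θbar)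
    (hmargin : ∀ s, 1 ≤ TwoLayerReLU.margin xI xJ θbar s)
    (hne : (supportVectors xI xJ θbar).Nonempty) {s : I ⊕ J} (hO : c =O[atTop] g)
    (ho : s ∈ supportVectors xI xJ θbar → c =o[atTop] g) :
    (fun t => c t * lossWeight (TwoLayerReLU.margin xI xJ (θ t) s)) =o[atTop]
      fun t => g t * ∑ s, lossWeight (TwoLayerReLU.margin xI xJ (θ t) s) := by
  have hle : ∀ s : I ⊕ J, (fun t => lossWeight (TwoLayerReLU.margin xI xJ (θ t) s)) =O[atTop]
      fun t => ∑ s, lossWeight (TwoLayerReLU.margin xI xJ (θ t) s) := fun s => by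
    refine Asymptotics.isBigO_of_le _ fun t => ?_
    rw [Real.norm_of_nonneg (lossWeight_pos _).le,
      Real.norm_of_nonneg (Finset.sum_nonneg fun s _ => (lossWeight_pos _).le)]
    exact Finset.single_le_sum
      (f := fun s => lossWeight (TwoLayerReLU.margin xI xJ (θ t) s))
      (fun s _ => (lossWeight_pos _).le) (Finset.mem_univ s)
  by_cases hs : s ∈ supportVectors xI xJ θbar
  · exact (ho hs).mul_isBigO (hle s)
  · obtain ⟨s', hs'⟩ := hne
    rw [mem_supportVectors_iff] at hs hs'
    exact hO.mul_isLittleO ((H.lossWeight_isLittleO ((hmargin s).lt_of_ne' hs) hs').trans_isBigO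
      (hle s'))

/-- The Karush–Kuhn–Tucker conditions in asymptotic form: nonnegative multipliers `α s t` of the
support vectors, namely averages of the loss weights along the flow, whose sum tends to `‖w̄‖²` and
for which the combination of the support vectors activating node `k` tends to `V̄_k / w̄_k`. -/
theorem IsGradientFlow.exists_multipliers (hflow : IsGradientFlow xI xJ θ)
    (hw : 0 < ∑ k, θbar.w k ^ 2) (H : HasScaledLimit θ (fun t => overlap θbar (θ t)) θbar)
    (hmargin : ∀ s, 1 ≤ margin xI xJ θbar s) (hne : (supportVectors xI xJ θbar).Nonempty)
    (hkink : ∀ s ∈ supportVectors xI xJ θbar, ∀ k, θbar.w k ≠ 0 →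
      preact θbar (Sum.elim xI xJ s) k = 0 →
        ∀ᶠ t in atTop, preact (θ t) (Sum.elim xI xJ s) k ≤ 0) :
    ∃ α : I ⊕ J → ℝ → ℝ, (∀ s, ∀ᶠ t in atTop, 0 ≤ α s t) ∧
      Tendsto (fun t => ∑ s ∈ supportVectors xI xJ θbar, α s t) atTop
        (𝓝 (∑ k, θbar.w k ^ 2)) ∧
      ∀ k, θbar.w k ≠ 0 → ∀ l, Tendsto (fun t => ∑ s ∈ activeSupport xI xJ θbar k,
        Sum.elim xI xJ s l * (label s * α s t)) atTop (𝓝 (θbar.V k l / θbar.w k)) := by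
  classical
  set W := ∑ k, θbar.w k ^ 2 with hW
  set g : ℝ → ℝ := fun t => overlap θbar (θ t) with hg
  set p : I ⊕ J → ℝ → ℝ := fun s t => lossWeight (margin xI xJ (θ t) s) with hp
  have hp0 : ∀ s t, 0 ≤ p s t := fun s t => (lossWeight_pos _).le
  have hg0 : ∀ᶠ t in atTop, 0 < g t := H.scale.eventually_gt_atTop 0
  have hgne : ∀ᶠ t in atTop, g t ≠ 0 := hg0.mono fun t => ne_of_gt
  -- `P` is the derivative of `W * g` along the flow, with coefficient `R s` at the weight of `s`.
  set P : ℝ → ℝ := fun τ => ∑ k, θbar.w k * negGradW xI xJ (θ τ) k with hPdef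
  set R : I ⊕ J → ℝ → ℝ := fun s τ =>
    label s * ∑ k, θbar.w k * max (preact (θ τ) (Sum.elim xI xJ s) k) 0 with hR
  have hP : ∀ τ, P τ = ∑ s, R s τ * p s τ := by
    intro τ
    simp only [hPdef, negGradW_eq_sum, hR, hp, Finset.mul_sum, Finset.sum_mul]
    rw [Finset.sum_comm]
    exact Finset.sum_congr rfl fun s _ => Finset.sum_congr rfl fun k _ => by ring
  have hRlim : ∀ s, Tendsto (fun t => R s t / g t) atTop (𝓝 (margin xI xJ θbar s)) := by
    intro s
    refine ((tendsto_finsetSum Finset.univ fun k _ =>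
      (H.relu (Sum.elim xI xJ s) k).const_mul (θbar.w k)).const_mul (label s)).congr fun t => ?_
    simp only [hR, mul_div_assoc, Finset.sum_div, hg]
  have hPprim : ∀ t, 0 ≤ t → IntervalIntegrable P volume 0 t ∧
      W * g t = W * g 0 + ∫ τ in (0 : ℝ)..t, P τ := by
    intro t ht
    have hi : ∀ k ∈ Finset.univ, IntervalIntegrable
        (fun τ => θbar.w k * negGradW xI xJ (θ τ) k) volume 0 t := fun k _ =>
      ((hflow.flow_w k t ht).1).const_mul (θbar.w k)
    have hWg : ∀ t, W * g t = ∑ k, θbar.w k * (θ t).w k := fun t =>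
      mul_div_cancel₀ _ hw.ne'
    refine ⟨by simpa only [Finset.sum_fn] using! IntervalIntegrable.sum Finset.univ hi, ?_⟩
    rw [hWg, hWg, intervalIntegral.integral_finsetSum hi, ← Finset.sum_add_distrib]
    refine Finset.sum_congr rfl fun k _ => ?_
    rw [intervalIntegral.integral_const_mul, ← mul_add, ← (hflow.flow_w k t ht).2]
  -- Every margin is at least `1` in the limit, so eventually `R s ≥ g / 2`.
  obtain ⟨T, hT0, hgT, hRT⟩ : ∃ T, 0 ≤ T ∧ (∀ t, T ≤ t → 0 < g t) ∧
      ∀ t, T ≤ t → ∀ s, g t ≤ 2 * R s t := by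
    have h1 : ∀ᶠ t in atTop, ∀ s, g t ≤ 2 * R s t := by
      rw [eventually_all]
      intro s
      filter_upwards [(hRlim s).eventually_const_lt
        (show 1 / 2 < margin xI xJ θbar s by linarith [hmargin s]), hg0] with t ht h0
      rw [lt_div_iff₀ h0] at ht
      linarith
    obtain ⟨T, hT⟩ := eventually_atTop.1 (hg0.and h1)
    exact ⟨max T 0, le_max_right _ _, fun t ht => (hT t ((le_max_left _ _).trans ht)).1,
      fun t ht => (hT t ((le_max_left _ _).trans ht)).2⟩
  have hpc : ∀ s, ContinuousOn (p s) (Set.Ici 0) := hflow.continuousOn_lossWeight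
  have hgc : ContinuousOn g (Set.Ici 0) := hflow.continuousOn_overlap
  have hC : ∀ t, T ≤ t → ∫ τ in T..t, g τ * ∑ s, p s τ ≤ (2 * W) * g t := by
    intro t ht
    have hPi : IntervalIntegrable P volume T t :=
      intervalIntegrable_of_nonneg (fun t ht => (hPprim t ht).1) hT0 (hT0.trans ht)
    calc ∫ τ in T..t, g τ * ∑ s, p s τ ≤ ∫ τ in T..t, 2 * P τ := by
          refine intervalIntegral.integral_mono_on ht ?_ (hPi.const_mul 2) fun τ hτ => ?_
          · refine ((hgc.mul (continuousOn_finsetSum _ fun s _ => hpc s)).mono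
              fun x hx => ?_).intervalIntegrable
            rw [Set.uIcc_of_le ht] at hx
            exact hT0.trans hx.1
          · rw [hP, Finset.mul_sum, Finset.mul_sum]
            refine Finset.sum_le_sum fun s _ => ?_
            rw [← mul_assoc]
            exact mul_le_mul_of_nonneg_right (hRT τ hτ.1 s) (hp0 s τ)
      _ = 2 * (W * g t - W * g T) := by
          rw [intervalIntegral.integral_const_mul, sub_eq_integral_of_primitive
            (f := fun t => W * g t) hPprim hT0 (hT0.trans ht)]
      _ ≤ (2 * W) * g t := by nlinarith [mul_pos hw (hgT T le_rfl)]
  have key : ∀ {f φ : ℝ → ℝ} {c : ℝ} {d : I ⊕ J → ℝ} {a : I ⊕ J → ℝ → ℝ},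
      (∀ t, 0 ≤ t → IntervalIntegrable φ volume 0 t ∧ f t = f 0 + ∫ τ in (0 : ℝ)..t, φ τ) →
      Tendsto (fun t => f t / g t) atTop (𝓝 c) → (∀ τ, φ τ = ∑ s, a s τ * p s τ) →
      (∀ s, (a s) =O[atTop] g) →
      (∀ s, s ∉ supportVectors xI xJ θbar → d s = 0) →
      (∀ s ∈ supportVectors xI xJ θbar, (fun τ => a s τ - d s * g τ) =o[atTop] g) →
      Tendsto (fun t => ∑ s, d s * ((∫ τ in T..t, g τ * p s τ) / g t)) atTop (𝓝 c) := by
    intro f φ c d a hf hfc hφ haO hd hao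
    refine tendsto_sum_mul_average hT0 H.scale hf hgc hpc hp0 hgT hC hfc ?_
    have hsum : (fun τ => φ τ - ∑ s, d s * (g τ * p s τ)) =
        fun τ => ∑ s, (a s τ - d s * g τ) * p s τ := by
      funext τ
      rw [hφ, ← Finset.sum_sub_distrib]
      exact Finset.sum_congr rfl fun s _ => by ring
    rw [hsum]
    simpa only [Finset.sum_fn] using! Asymptotics.IsLittleO.sum (s := Finset.univ) fun s _ =>
      H.mul_lossWeight_isLittleO hmargin hne
      ((haO s).sub ((Asymptotics.isBigO_refl g atTop).const_mul_left (d s))) (hao s)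
  have hbigO : ∀ {f : ℝ → ℝ} {c : ℝ}, Tendsto (fun t => f t / g t) atTop (𝓝 c) →
      f =O[atTop] g := fun h =>
    Asymptotics.isBigO_of_div_tendsto_nhds (hgne.mono fun t ht h0 => absurd h0 ht) _ h
  refine ⟨fun s t => (∫ τ in T..t, g τ * p s τ) / g t, fun s => ?_, ?_, fun k hk l => ?_⟩
  · filter_upwards [eventually_ge_atTop T] with t ht
    exact div_nonneg (intervalIntegral.integral_nonneg ht fun τ hτ =>
      mul_nonneg (hgT τ hτ.1).le (hp0 s τ)) (hgT t ht).le
  · have h := key (d := fun s => if s ∈ supportVectors xI xJ θbar then 1 else 0) hPprim (c := W)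
      (tendsto_const_nhds.congr' (hgne.mono fun t ht => (mul_div_cancel_right₀ W ht).symm)) hP
      (fun s => hbigO (hRlim s)) (fun s hs => if_neg hs) (fun s hs => by
        simpa only [if_pos hs, (mem_supportVectors_iff s).1 hs] using
          sub_const_mul_isLittleO hgne (hRlim s))
    simpa only [ite_mul, one_mul, zero_mul, Finset.sum_ite_mem, Finset.univ_inter] using h
  · have hsub : activeSupport xI xJ θbar k ⊆ supportVectors xI xJ θbar := Finset.filter_subset _ _
    have h := key (d := fun s => if s ∈ activeSupport xI xJ θbar k then
        label s * Sum.elim xI xJ s l * θbar.w k else 0) (hflow.flow_V k l) (H.V k l)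
      (fun τ => negGradV_eq_sum xI xJ (θ τ) k l) (fun s => ?_)
      (fun s hs => if_neg fun h => hs (hsub h)) (fun s hs => ?_)
    · have h2 := h.div_const (θbar.w k)
      refine h2.congr fun t => ?_
      simp only [ite_mul, zero_mul, Finset.sum_ite_mem, Finset.univ_inter]
      rw [Finset.sum_div]
      refine Finset.sum_congr rfl fun s _ => ?_
      field_simp
    · refine Asymptotics.IsBigO.const_mul_left ?_ _
      refine Asymptotics.IsBigO.trans (Asymptotics.isBigO_of_le _ fun t => ?_) (hbigO (H.w k))
      unfold gate
      split_ifs <;> simp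
    · by_cases hpos : 0 < preact θbar (Sum.elim xI xJ s) k
      · have hmem : s ∈ activeSupport xI xJ θbar k := Finset.mem_filter.2 ⟨hs, hpos⟩
        refine ((sub_const_mul_isLittleO hgne (H.w k)).const_mul_left
          (label s * Sum.elim xI xJ s l)).congr' ?_ EventuallyEq.rfl
        filter_upwards [H.gate_eventually_eq_one _ hpos] with t ht
        rw [if_pos hmem, ht]
        ring
      · have hmem : s ∉ activeSupport xI xJ θbar k := fun h => hpos (Finset.mem_filter.1 h).2
        have hev : ∀ᶠ t in atTop, preact (θ t) (Sum.elim xI xJ s) k ≤ 0 := by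
          rcases (not_lt.1 hpos).lt_or_eq with h | h
          · exact H.preact_eventually_nonpos _ h
          · exact hkink s hs k hk h
        refine (Asymptotics.isLittleO_zero g atTop).congr' ?_ EventuallyEq.rfl
        filter_upwards [hev] with t ht
        rw [if_neg hmem, gate, if_neg (not_lt.2 ht)]
        ring

/-! ### The Lipschitz bound -/

theorem sum_sq_V_row_nonneg (k : Fin r) : 0 ≤ ∑ l, θbar.V k l ^ 2 :=
  Finset.sum_nonneg fun _ _ => sq_nonneg _

/-- Each balanced node contributes at most `|w̄_k| ‖V̄_k‖ ≤ w̄_k²` to the Lipschitz constant. -/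
theorem lipschitzWith_network {C : ℝ}
    (hbal : ∀ k, ∑ l, θbar.V k l ^ 2 ≤ θbar.w k ^ 2) (hC : ∑ k, θbar.w k ^ 2 ≤ C) :
    LipschitzWith C.toNNReal (network θbar) := by
  refine LipschitzWith.of_dist_le_mul fun x y => ?_
  have hC0 : 0 ≤ C := (Finset.sum_nonneg fun _ _ => sq_nonneg _).trans hC
  rw [Real.coe_toNNReal _ hC0, Real.dist_eq, network, network, ← Finset.sum_sub_distrib]
  refine (Finset.abs_sum_le_sum_abs _ _).trans ?_
  refine (Finset.sum_le_sum fun k _ => ?_).trans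
    ((Finset.sum_mul _ _ _).symm.le.trans (mul_le_mul_of_nonneg_right hC dist_nonneg))
  rw [← mul_sub, abs_mul, ← sq_abs (θbar.w k), sq, mul_assoc]
  refine mul_le_mul_of_nonneg_left ?_ (abs_nonneg _)
  refine (abs_max_sub_max_le_abs _ _ _).trans ?_
  have h1 : preact θbar x k - preact θbar y k = ∑ l, θbar.V k l * (x l - y l) := by
    simp only [preact, mul_sub, Finset.sum_sub_distrib]
    ring
  rw [h1, EuclideanSpace.dist_eq, ← Real.sqrt_sq_eq_abs (θbar.w k), ← Real.sqrt_mul (sq_nonneg _)]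
  refine Real.abs_le_sqrt ((Finset.sum_mul_sq_le_sq_mul_sq _ _ _).trans ?_)
  simp only [Real.dist_eq, sq_abs]
  exact mul_le_mul_of_nonneg_right (hbal k) (Finset.sum_nonneg fun _ _ => sq_nonneg _)

theorem card_activeSupport_le_nSupMax (k : Fin r) :
    (activeSupport xI xJ θbar k).card ≤ nSupMax xI xJ θbar := by
  classical
  refine le_trans ?_ (Finset.le_sup (Finset.mem_univ k))
  refine Finset.le_sup (f := Finset.card) (Finset.mem_filter.2 ⟨?_, fun s hs => ?_⟩)
  · exact Finset.mem_powerset.2 (Finset.filter_subset _ _)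
  · exact (Finset.mem_filter.1 hs).2

/-- The minimum in the definition of `nNodeMin` is attained, because the set of all nodes is
admissible: the network does not vanish at a support vector. -/
theorem exists_card_eq_nNodeMin :
    ∃ K : Finset (Fin r), K.card = nNodeMin xI xJ θbar ∧
      ∀ s ∈ supportVectors xI xJ θbar, ∃ k ∈ K, 0 < preact θbar (Sum.elim xI xJ s) k := by
  refine Nat.sInf_mem (s := {m : ℕ | ∃ K : Finset (Fin r), K.card = m ∧
    ∀ s ∈ supportVectors xI xJ θbar, ∃ k ∈ K, 0 < preact θbar (Sum.elim xI xJ s) k})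
    ⟨_, Finset.univ, rfl, fun s hs => ?_⟩
  rw [mem_supportVectors_iff] at hs
  by_contra! h
  have h0 : network θbar (Sum.elim xI xJ s) = 0 :=
    Finset.sum_eq_zero fun k _ => by rw [max_eq_right (h k (Finset.mem_univ k)), mul_zero]
  rw [margin, h0, mul_zero] at hs
  exact zero_ne_one hs

/-- If the incoming weights of a node are bounded by its outgoing weight, then the multipliers of
the support vectors activating it eventually sum to at most `√nSupMax / √lam`, up to `ε`. -/
theorem sum_multipliers_le {k : Fin r} {lam : ℝ} (hlam : 0 < lam)
    (hgram : ∀ μ : ℝ, Module.End.HasEigenvalue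
      (Matrix.mulVecLin ((supportMatrix xI xJ θbar k).transpose * supportMatrix xI xJ θbar k)) μ →
        lam ≤ μ) (hbal : ∑ l, θbar.V k l ^ 2 ≤ θbar.w k ^ 2)
    {α : I ⊕ J → ℝ → ℝ}
    (hα : ∀ l, Tendsto (fun t => ∑ s ∈ activeSupport xI xJ θbar k,
        Sum.elim xI xJ s l * (label s * α s t)) atTop (𝓝 (θbar.V k l / θbar.w k)))
    {ε : ℝ} (hε : 0 < ε) : ∀ᶠ t in atTop, ∑ s ∈ activeSupport xI xJ θbar k, α s t ≤
      √(nSupMax xI xJ θbar : ℝ) / √lam + ε := by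
  have hlim : Tendsto (fun t => √((nSupMax xI xJ θbar : ℝ) / lam * ∑ l,
      (∑ s ∈ activeSupport xI xJ θbar k, Sum.elim xI xJ s l * (label s * α s t)) ^ 2)) atTop
      (𝓝 √((nSupMax xI xJ θbar : ℝ) / lam * ∑ l, (θbar.V k l / θbar.w k) ^ 2)) :=
    ((tendsto_finsetSum Finset.univ fun l _ => (hα l).pow 2).const_mul _).sqrt
  have hle : √((nSupMax xI xJ θbar : ℝ) / lam * ∑ l, (θbar.V k l / θbar.w k) ^ 2) ≤
      √(nSupMax xI xJ θbar : ℝ) / √lam := by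
    rw [← Real.sqrt_div (Nat.cast_nonneg _)]
    refine Real.sqrt_le_sqrt (mul_le_of_le_one_right (by positivity) ?_)
    simp only [div_pow, ← Finset.sum_div]
    exact div_le_one_of_le₀ hbal (sq_nonneg _)
  filter_upwards [hlim.eventually_lt_const (lt_of_le_of_lt hle (lt_add_of_pos_right _ hε))]
    with t ht
  refine le_trans (Real.le_sqrt_of_sq_le ?_) ht.le
  have h1 := mul_sum_sq_le_of_gram_eigenvalues _ hgram fun s => label s.1 * α s.1 t
  have h2 : ∑ s : activeSupport xI xJ θbar k, (label s.1 * α s.1 t) ^ 2 =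
      ∑ s ∈ activeSupport xI xJ θbar k, α s t ^ 2 := by
    rw [Finset.sum_coe_sort (activeSupport xI xJ θbar k) fun s => (label s * α s t) ^ 2]
    refine Finset.sum_congr rfl fun s _ => ?_
    rw [mul_pow, sq (label s), label_mul_self, one_mul]
  have h3 : ∀ l, (supportMatrix xI xJ θbar k).mulVec (fun s => label s.1 * α s.1 t) l =
      ∑ s ∈ activeSupport xI xJ θbar k, Sum.elim xI xJ s l * (label s * α s t) := fun l =>
    Finset.sum_coe_sort (activeSupport xI xJ θbar k)
      fun s => Sum.elim xI xJ s l * (label s * α s t)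
  simp only [h2, h3] at h1
  have h4 : (∑ s ∈ activeSupport xI xJ θbar k, α s t) ^ 2 ≤
      (nSupMax xI xJ θbar : ℝ) * ∑ s ∈ activeSupport xI xJ θbar k, α s t ^ 2 :=
    sq_sum_le_card_mul_sum_sq.trans (mul_le_mul_of_nonneg_right
      (Nat.cast_le.2 (card_activeSupport_le_nSupMax k))
      (Finset.sum_nonneg fun _ _ => sq_nonneg _))
  refine h4.trans ?_
  rw [div_mul_eq_mul_div, mul_div_assoc]
  exact mul_le_mul_of_nonneg_left ((le_div_iff₀' hlam).2 h1) (Nat.cast_nonneg _)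

end Flow

end TwoLayerReLU

open TwoLayerReLU Filter in
theorem theorem3 {r n : ℕ} {I J : Type*} [Fintype I] [Fintype J]
    (xI : I → EuclideanSpace ℝ (Fin n)) (xJ : J → EuclideanSpace ℝ (Fin n))
    (θ : ℝ → Params r n) (θbar : Params r n)
    -- training by continuous-time gradient descent on the cross-entropy loss
    (hflow : IsGradientFlow xI xJ θ)
    -- all training points are (eventually) correctly classified
    (hclassI : ∀ i, ∀ᶠ t in atTop, 0 < network (θ t) (xI i))
    (hclassJ : ∀ j, ∀ᶠ t in atTop, network (θ t) (xJ j) < 0)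
    -- convergence in direction
    (hdir : ConvergesInDirection θ θbar)
    -- the scaling of the limit
    (hI : ∀ i, 1 ≤ network θbar (xI i))
    (hJ : ∀ j, network θbar (xJ j) ≤ -1)
    (hsup : (∃ i, network θbar (xI i) = 1) ∨ ∃ j, network θbar (xJ j) = -1)
    -- switching ends: a support vector that does not activate a node of the limit network
    -- eventually does not activate this node during the training either
    -- (automatic unless its pre-activation in the limit network is exactly zero)
    (hkink : ∀ s ∈ supportVectors xI xJ θbar, ∀ k, θbar.w k ≠ 0 →
      preact θbar (Sum.elim xI xJ s) k = 0 →
        ∀ᶠ t in atTop, preact (θ t) (Sum.elim xI xJ s) k ≤ 0)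
    -- a positive lower bound for the eigenvalues of all the Gram matrices `X_kᵀ X_k`
    (lam : ℝ) (hlam : 0 < lam)
    (hgram : ∀ k, ∀ μ : ℝ, Module.End.HasEigenvalue
      (Matrix.mulVecLin ((supportMatrix xI xJ θbar k).transpose * supportMatrix xI xJ θbar k)) μ →
        lam ≤ μ) :
    LipschitzWith
      (Real.toNNReal ((nNodeMin xI xJ θbar : ℝ) * √(nSupMax xI xJ θbar : ℝ) / √lam))
      (network θbar) := by
  have hmargin : ∀ s, 1 ≤ margin xI xJ θbar s := by
    rintro (i | j)
    · simpa [margin, label] using hI i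
    · simpa [margin, label] using le_neg_of_le_neg (hJ j)
  have hne : (supportVectors xI xJ θbar).Nonempty := by
    rcases hsup with ⟨i, hi⟩ | ⟨j, hj⟩
    · exact ⟨Sum.inl i, (mem_supportVectors_iff _).2 (by simpa [margin, label] using hi)⟩
    · exact ⟨Sum.inr j, (mem_supportVectors_iff _).2 (by simp [margin, label, hj])⟩
  have hw : 0 < ∑ k, θbar.w k ^ 2 := by
    refine (Finset.sum_nonneg fun _ _ => sq_nonneg _).lt_of_ne' fun h0 => ?_
    obtain ⟨s, -⟩ := hne
    have hz : ∀ k, θbar.w k = 0 := fun k => by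
      simpa using (Finset.sum_eq_zero_iff_of_nonneg fun _ _ => sq_nonneg _).1 h0 k
        (Finset.mem_univ k)
    have := hmargin s
    simp only [margin, network, hz, zero_mul, Finset.sum_const_zero, mul_zero] at this
    linarith
  obtain ⟨h, Hh⟩ := hdir.exists_hasScaledLimit
  have H := Hh.overlap hw.ne'
  have hbal := hflow.balance_limit H
  have hbalV : ∀ k, ∑ l, θbar.V k l ^ 2 ≤ θbar.w k ^ 2 := fun k => by
    linarith [hbal k, sq_nonneg (θbar.b k)]
  obtain ⟨α, hα0, hαsum, hαV⟩ := hflow.exists_multipliers hw H hmargin hne hkink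
  refine lipschitzWith_network hbalV ?_
  -- By balance, a node with vanishing outgoing weight is identically zero, hence never active.
  have hdead : ∀ k, θbar.w k = 0 → activeSupport xI xJ θbar k = ∅ := by
    intro k hk
    have hb := hbal k
    rw [hk, zero_pow two_ne_zero] at hb
    have hV0 : ∑ l, θbar.V k l ^ 2 = 0 := le_antisymm
      (by linarith [sq_nonneg (θbar.b k)]) (sum_sq_V_row_nonneg k)
    have hb0 : θbar.b k = 0 := by
      have : θbar.b k ^ 2 = 0 := by linarith
      simpa using this
    have hV : ∀ l, θbar.V k l = 0 := fun l => by
      simpa using (Finset.sum_eq_zero_iff_of_nonneg fun _ _ => sq_nonneg _).1 hV0 l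
        (Finset.mem_univ l)
    refine Finset.filter_eq_empty_iff.2 fun s _ => ?_
    simp [preact, hV, hb0]
  obtain ⟨K, hK, hKs⟩ := exists_card_eq_nNodeMin (xI := xI) (xJ := xJ) (θbar := θbar)
  set B := √(nSupMax xI xJ θbar : ℝ) / √lam with hB
  have hB0 : 0 ≤ B := by positivity
  rw [mul_div_assoc, ← hB, ← hK]
  have hε : ∀ ε : ℝ, 0 < ε → ∑ k, θbar.w k ^ 2 ≤ (K.card : ℝ) * (B + ε) := by
    intro ε hε
    refine le_of_tendsto hαsum ?_
    have hnode : ∀ᶠ t in atTop, ∀ k, ∑ s ∈ activeSupport xI xJ θbar k, α s t ≤ B + ε := by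
      rw [eventually_all]
      intro k
      by_cases hk : θbar.w k = 0
      · refine Eventually.of_forall fun t => ?_
        rw [hdead k hk, Finset.sum_empty]
        positivity
      · exact sum_multipliers_le hlam (hgram k) (hbalV k) (hαV k hk) hε
    filter_upwards [hnode, eventually_all.2 hα0] with t ht h0
    calc ∑ s ∈ supportVectors xI xJ θbar, α s t
        ≤ ∑ s ∈ supportVectors xI xJ θbar,
            ∑ k ∈ K, if 0 < preact θbar (Sum.elim xI xJ s) k then α s t else 0 := by
          refine Finset.sum_le_sum fun s hs => ?_
          obtain ⟨k, hk, hpos⟩ := hKs s hs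
          refine (if_pos hpos).symm.le.trans (Finset.single_le_sum
            (f := fun k => if 0 < preact θbar (Sum.elim xI xJ s) k then α s t else 0)
            (fun k _ => ?_) hk)
          split_ifs
          exacts [h0 s, le_rfl]
      _ = ∑ k ∈ K, ∑ s ∈ activeSupport xI xJ θbar k, α s t := by
          rw [Finset.sum_comm]
          simp only [activeSupport, Finset.sum_filter]
      _ ≤ ∑ _k ∈ K, (B + ε) := Finset.sum_le_sum fun k _ => ht k
      _ = (K.card : ℝ) * (B + ε) := by rw [Finset.sum_const, nsmul_eq_mul]
  have hlim : Tendsto (fun ε : ℝ => (K.card : ℝ) * (B + ε)) (nhdsWithin 0 (Set.Ioi 0))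
      (nhds ((K.card : ℝ) * (B + 0))) :=
    ((continuous_const.mul (continuous_const.add continuous_id)).tendsto 0).mono_left
      nhdsWithin_le_nhds
  rw [add_zero] at hlim
  exact ge_of_tendsto hlim (by filter_upwards [self_mem_nhdsWithin] with ε h using hε ε h)
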